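/- **Setting.** Let $\Phi=(\phi_1,\dots,\phi_m)$ be a frame for $\mathbb{R}^n$, $n\ge 1$: a finite family for which there are $0<\alpha\le\beta$ with $\alpha\|x\|^2\le\sum_i|\langle x,\phi_i\rangle|^2\le\beta\|x\|^2$ for all $x$. Let $\mathbf T=[\phi_1|\cdots|\phi_m]^T$ be its analysis matrix and $\mathbf S=\mathbf T^T\mathbf T=\sum_i\phi_i\phi_i^T$ its frame matrix. For $\sigma>0$ and $x_0\in\mathbb{R}^n$ let $\rho_d(\Phi)=\sqrt{\mathbb E\|\hat x_0-x_0\|^2}$, where $\hat x_0=\mathbf S^{-1}\mathbf T^T(\mathbf T x_0+\xi)$ is the least-squares estimate of $x_0$ from noisy observations with $\xi\sim\mathcal N(0,\sigma^2\mathbf I)$ (for a frame this does not depend on $x_0$), and let $\rho_e(\Phi)=-\sum_{i=1}^n\log\lambda_i(\mathbf S)$, where $\lambda_i(\mathbf S)$ are the eigenvalues of $\mathbf S$. **Algorithm.** Let $\pi(\phi_i)=\frac1n\phi_i^T\mathbf S^{-1}\phi_i$ (leverage score divided by $n$), a probability mass function on the index set of $\Phi$. Given $q\ge1$, start with $\Phi_s=\varnothing$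 and $w_s=0$. Then $q$ times, independently and with replacement, draw an element $\phi$ of the family $\Phi$ (that is, an index) with law $\pi$, replace $w_s(\phi)$ by $w_s(\phi)+(q\,\pi(\phi))^{-1}$, and add $\phi$ to $\Phi_s$ if it is not already there. Return $\Phi_s$ and $w_s$. Define the random variable $$\chi=\inf\Big\{\gamma>0\ \Big|\ \sum_{\phi\in\Phi}w_s(\phi)\big(\gamma-w_s(\phi)\big)\,\phi\phi^T\succeq 0\Big\},\qquad \bar\chi=\mathbb E\{\chi\}.$$ **Theorem.** There is an absolute constant $C>0$ such that, for all $n\ge1$, every frame $\Phi$ for $\mathbb{R}^n$, every $\epsilon\in(1/\sqrt n,1]$ and every integer $q\ge C\,n\log n/\epsilon^2$ (in particular for $q=\lceil C\,n\log n/\epsilon^2\rceil=O(n\log n/\epsilon^2)$), the following hold. 1. With probability at least $1/2$, $\Phi_s$ is a frame for $\mathbb{R}^n$. 2. If $\epsilon<1$, then for every $\sigma>0$ and $x_0\in\mathbb{R}^n$, with probability at least $1/4$ the family $\Phi_s$ is a frame and both $$\frac{\rho_d(\Phi_s)-\rho_d(\Phi)}{\rho_d(\Phi)}\le -1+\sqrt{\frac{4\bar\chi}{1-\epsilon}},\qquad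 \rho_e(\Phi_s)-\rho_e(\Phi)\le n\log\Big(\frac{4\bar\chi}{1-\epsilon}\Big)$$ hold. Moreover, both right-hand sides are nonnegative. -/

import Mathlib

open MeasureTheory ProbabilityTheory

namespace FrameSparsification

section Frames

variable {n : ℕ} {ι : Type*} [Fintype ι]

/-- The family `Φ` of vectors is a frame for `ℝⁿ`. -/
def IsFrame (Φ : ι → EuclideanSpace ℝ (Fin n)) : Prop :=
  ∃ α β : ℝ, 0 < α ∧ α ≤ β ∧ ∀ x : EuclideanSpace ℝ (Fin n),
    α * ‖x‖ ^ 2 ≤ ∑ i, |inner ℝ x (Φ i)| ^ 2 ∧ ∑ i, |inner ℝ x (Φ i)| ^ 2 ≤ β * ‖x‖ ^ 2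

/-- The matrix of the analysis operator: its rows are the vectors of the family. -/
def analysisMatrix (Φ : ι → EuclideanSpace ℝ (Fin n)) : Matrix ι (Fin n) ℝ :=
  Matrix.of fun i a => Φ i a

/-- The frame matrix `S = Tᵀ T`. -/
def frameMatrix (Φ : ι → EuclideanSpace ℝ (Fin n)) : Matrix (Fin n) (Fin n) ℝ :=
  (analysisMatrix Φ).transpose * analysisMatrix Φ

theorem frameMatrix_isHermitian (Φ : ι → EuclideanSpace ℝ (Fin n)) :
    (frameMatrix Φ).IsHermitian :=
  Matrix.isHermitian_conjTranspose_mul_self (analysisMatrix Φ)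

/-- The rank-one matrix `v vᵀ`. -/
def outer (v : EuclideanSpace ℝ (Fin n)) : Matrix (Fin n) (Fin n) ℝ :=
  Matrix.of fun a b => v a * v b

/-- The least-squares estimate `T† y`, where `T† = S⁻¹ Tᵀ`. -/
noncomputable def lsEstimate (Φ : ι → EuclideanSpace ℝ (Fin n)) (y : ι → ℝ) :
    EuclideanSpace ℝ (Fin n) :=
  WithLp.toLp 2
    (((frameMatrix Φ)⁻¹ * (analysisMatrix Φ).transpose).mulVec y)

/-- The law of the noise: independent centred Gaussians with standard deviation `σ`. -/
noncomputable def noiseLaw (ι : Type*) [Fintype ι] (σ : ℝ) : Measure (ι → ℝ) :=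
  Measure.pi fun _ => gaussianReal 0 (Real.toNNReal (σ ^ 2))

/-- The standard deviation of the error of the least-squares estimate of `x₀` from the noisy
observations `T x₀ + ξ`. For a frame it does not depend on `x₀`. -/
noncomputable def rhoD (σ : ℝ) (x₀ : EuclideanSpace ℝ (Fin n))
    (Φ : ι → EuclideanSpace ℝ (Fin n)) : ℝ :=
  Real.sqrt (∫ ξ, ‖lsEstimate Φ ((analysisMatrix Φ).mulVec x₀.ofLp + ξ) - x₀‖ ^ 2
    ∂(noiseLaw ι σ))

/-- The entropy measure `-∑ log λᵢ(S)`. -/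
noncomputable def rhoE (Φ : ι → EuclideanSpace ℝ (Fin n)) : ℝ :=
  -∑ i, Real.log ((frameMatrix_isHermitian Φ).eigenvalues i)

/-- The leverage score `φᵢᵀ S⁻¹ φᵢ`. -/
noncomputable def leverage (Φ : ι → EuclideanSpace ℝ (Fin n)) (i : ι) : ℝ :=
  (Φ i).ofLp ⬝ᵥ (frameMatrix Φ)⁻¹.mulVec (Φ i).ofLp

/-- The sampling probability `π(φᵢ)`: the leverage score divided by `n`. -/
noncomputable def samplingProb (Φ : ι → EuclideanSpace ℝ (Fin n)) (i : ι) : ℝ :=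
  leverage Φ i / n

theorem analysisMatrix_mulVec {κ : Type*} (Φ : κ → EuclideanSpace ℝ (Fin n)) (x : Fin n → ℝ) (i : κ) :
    (analysisMatrix Φ).mulVec x i = inner ℝ (WithLp.toLp 2 x) (Φ i) := by
  simp [analysisMatrix, Matrix.mulVec, dotProduct, PiLp.inner_apply]

theorem IsFrame.posDef {Φ : ι → EuclideanSpace ℝ (Fin n)} (hΦ : IsFrame Φ) :
    (frameMatrix Φ).PosDef := by
  obtain ⟨α, β, hα, -, h⟩ := hΦ
  refine Matrix.PosDef.of_dotProduct_mulVec_pos (frameMatrix_isHermitian Φ) fun x hx => ?_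
  have e : star x ⬝ᵥ (frameMatrix Φ).mulVec x
      = ∑ i, |inner ℝ (WithLp.toLp 2 x) (Φ i)| ^ 2 := by
    rw [frameMatrix, ← Matrix.mulVec_mulVec, Matrix.dotProduct_mulVec,
      Matrix.vecMul_transpose]
    simp [dotProduct, analysisMatrix_mulVec, pow_two]
  rw [e]
  refine lt_of_lt_of_le ?_ (h (WithLp.toLp 2 x)).1
  have : WithLp.toLp 2 x ≠ 0 := fun h0 => hx (by simpa using h0)
  positivity

theorem leverage_nonneg {Φ : ι → EuclideanSpace ℝ (Fin n)} (hΦ : IsFrame Φ) (i : ι) :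
    0 ≤ leverage Φ i := by
  simpa [leverage] using hΦ.posDef.inv.posSemidef.dotProduct_mulVec_nonneg (Φ i).ofLp

theorem sum_leverage {Φ : ι → EuclideanSpace ℝ (Fin n)} (hΦ : IsFrame Φ) :
    ∑ i, leverage Φ i = n := by
  have e : ∑ i, leverage Φ i
      = (analysisMatrix Φ * (frameMatrix Φ)⁻¹ * (analysisMatrix Φ).transpose).trace := by
    unfold Matrix.trace
    refine Finset.sum_congr rfl fun i _ => ?_
    rw [leverage, Matrix.dotProduct_mulVec]
    rfl
  have hu : IsUnit (frameMatrix Φ).det := (Matrix.isUnit_iff_isUnit_det _).1 hΦ.posDef.isUnit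
  rw [e, Matrix.trace_mul_comm, ← Matrix.mul_assoc]
  change (frameMatrix Φ * (frameMatrix Φ)⁻¹).trace = n
  rw [Matrix.mul_nonsing_inv _ hu]
  simp

/-- The leverage-score probability mass function `π` of a frame for `ℝⁿ`, `n ≥ 1`. -/
noncomputable def leveragePMF (Φ : ι → EuclideanSpace ℝ (Fin n)) (hn : 0 < n)
    (hΦ : IsFrame Φ) : PMF ι :=
  PMF.ofFintype (fun i => ENNReal.ofReal (samplingProb Φ i)) (by
    simp only [samplingProb]
    rw [← ENNReal.ofReal_sum_of_nonneg
      fun i _ => div_nonneg (leverage_nonneg hΦ i) (Nat.cast_nonneg n), ← Finset.sum_div, sum_leverage hΦ, div_self (by positivity), ENNReal.ofReal_one])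

end Frames

section Algorithm

variable {n m : ℕ}

/-- The state of the sparsification algorithm: the indices of the vectors selected so far (the
current `Φ_s`), the current weight function `w_s`, and the frame matrix `S_s`. -/
structure SparsState (n m : ℕ) where
  selected : Finset (Fin m)
  weight : Fin m → ℝ
  mat : Matrix (Fin n) (Fin n) ℝ

/-- The initial state: nothing is selected, the weights and the matrix are zero. -/
def initState (n m : ℕ) : SparsState n m := ⟨∅, fun _ => 0, 0⟩

/-- One pass through the loop, after the index `i` has been drawn. -/
noncomputable def stepState (Φ : Fin m → EuclideanSpace ℝ (Fin n)) (q : ℕ)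
    (st : SparsState n m) (i : Fin m) : SparsState n m where
  selected := if i ∈ st.selected then st.selected else insert i st.selected
  weight := Function.update st.weight i (st.weight i + ((q : ℝ) * samplingProb Φ i)⁻¹)
  mat := if i ∈ st.selected then st.mat else st.mat + outer (Φ i)

/-- The output of the algorithm when the successive draws are `ω 0, …, ω (q - 1)`. -/
noncomputable def runAlgorithm (Φ : Fin m → EuclideanSpace ℝ (Fin n)) {q : ℕ}
    (ω : Fin q → Fin m) : SparsState n m :=
  (List.ofFn ω).foldl (stepState Φ q) (initState n m)

/-- The joint law of the `q` independent draws (with replacement) from `π`. -/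
noncomputable def drawsLaw (Φ : Fin m → EuclideanSpace ℝ (Fin n)) (hn : 0 < n)
    (hΦ : IsFrame Φ) (q : ℕ) : Measure (Fin q → Fin m) :=
  Measure.pi fun _ => (leveragePMF Φ hn hΦ).toMeasure

/-- The family `Φ_s` returned by the algorithm. -/
noncomputable def sparsified (Φ : Fin m → EuclideanSpace ℝ (Fin n)) {q : ℕ}
    (ω : Fin q → Fin m) : {i // i ∈ (runAlgorithm Φ ω).selected} → EuclideanSpace ℝ (Fin n) :=
  fun i => Φ i

/-- The weight function `w_s` returned by the algorithm. -/
noncomputable def weights (Φ : Fin m → EuclideanSpace ℝ (Fin n)) {q : ℕ}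
    (ω : Fin q → Fin m) : Fin m → ℝ :=
  (runAlgorithm Φ ω).weight

/-- The random variable `χ`. -/
noncomputable def chi (Φ : Fin m → EuclideanSpace ℝ (Fin n)) {q : ℕ} (ω : Fin q → Fin m) : ℝ :=
  sInf {γ : ℝ | 0 < γ ∧
    (∑ i, (weights Φ ω i * (γ - weights Φ ω i)) • outer (Φ i)).PosSemidef}

/-- The expectation `χ̄` of `χ`. -/
noncomputable def chiBar (Φ : Fin m → EuclideanSpace ℝ (Fin n)) (hn : 0 < n)
    (hΦ : IsFrame Φ) (q : ℕ) : ℝ :=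
  ∫ ω, chi Φ ω ∂(drawsLaw Φ hn hΦ q)

end Algorithm

end FrameSparsification

open FrameSparsification

namespace FrameSparsification

/-! ### Trace inequalities for dyadic powers. -/

section TraceInequalities

open Matrix

variable {κ : Type*} [Fintype κ]

/-! Choose `B` with `B S Bᵀ = 1`. After whitening, a draw from `π` becomes a random projection of
rank at most one with mean `n⁻¹ • 1`, and the reweighted matrix `∑ w φφᵀ` becomes `n / q` times a
sum of `q` independent copies. The matrix Chernoff bound (`sum_prod_not_le`), obtained from
Golden–Thompson (`trace_exp_add_le`), then gives `∑ w φφᵀ ⪰ (1 - ε/2) S` with probability at least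
`1/2`.

The returned family carries no weights. The definition of `χ` gives `∑ w² φφᵀ ⪯ χ ∑ w φφᵀ`, and
Cauchy–Schwarz over the selected indices turns this into `∑ w φφᵀ ⪯ χ S_s`
(`sum_weights_le_chi_mul`). On a good draw, therefore, `χ > 0` and `S_s ⪰ ((1 - ε/2)/χ) S`, so `Φ_s`
is a frame.

By Markov, `χ ≥ 4 χ̄` has probability at most `1/4`, which leaves probability at least `1/4` for a
good draw with `χ ≤ 4 χ̄`. There `S_s ⪰ c S` with `c = (1 - ε)/(4 χ̄)`. Since `ρ_d² = σ² tr S⁻¹` and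
`ρ_e = -log det S`, both estimates follow from monotonicity in the Loewner order. Finally `S_s ⪯ S`
forces `c ≤ 1`, which is the nonnegativity claim. -/

theorem trace_mul_pow_comm [DecidableEq κ] (X Y : Matrix κ κ ℝ) (k : ℕ) :
    ((X * Y) ^ k).trace = ((Y * X) ^ k).trace := by
  cases k with
  | zero => simp
  | succ k =>
    have h : ∀ l : ℕ, (X * Y) ^ l * X = X * (Y * X) ^ l := by
      intro l
      induction l with
      | zero => simp
      | succ l ih => rw [pow_succ, Matrix.mul_assoc, Matrix.mul_assoc X Y X, ← Matrix.mul_assoc,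
          ih, Matrix.mul_assoc, ← pow_succ]
    rw [pow_succ, ← Matrix.mul_assoc, h, Matrix.mul_assoc, Matrix.trace_mul_comm, Matrix.mul_assoc,
      ← pow_succ]

theorem two_mul_trace_mul_le (X Y : Matrix κ κ ℝ) :
    2 * (X * Y).trace ≤ (X * Xᵀ).trace + (Y * Yᵀ).trace := by
  have h := (Matrix.posSemidef_self_mul_conjTranspose (X - Yᵀ)).trace_nonneg
  have e : (Yᵀ * Y).trace = (Y * Yᵀ).trace := Matrix.trace_mul_comm _ _
  have e2 : (Yᵀ * Xᵀ).trace = (X * Y).trace := by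
    rw [← Matrix.transpose_mul, Matrix.trace_transpose]
  simp only [conjTranspose_eq_transpose_of_trivial, transpose_sub, transpose_transpose,
    Matrix.sub_mul, Matrix.mul_sub, trace_sub] at h
  linarith

/-- The two statements feed each other. The first at `j + 1` applies the first at `j` to `Z²`,
cycles the trace to reach `(Z Zᵀ)(Zᵀ Z)`, separates powers by the second at `j`, and ends with
`two_mul_trace_mul_le`. The second at `j + 1` applies the first at `j` to `PQ`, then the second at
`j` to `P²` and `Q²`. -/
theorem trace_dyadic_pow_le [DecidableEq κ] (j : ℕ) :
    (∀ Z : Matrix κ κ ℝ, (Z ^ 2 ^ (j + 1)).trace ≤ ((Z * Zᵀ) ^ 2 ^ j).trace) ∧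
    ∀ P Q : Matrix κ κ ℝ, P.IsSymm → Q.IsSymm →
      ((P * Q) ^ 2 ^ j).trace ≤ (P ^ 2 ^ j * Q ^ 2 ^ j).trace := by
  induction j with
  | zero =>
    refine ⟨fun Z => ?_, fun P Q _ _ => by simp⟩
    have h := two_mul_trace_mul_le Z Z
    simp only [zero_add, pow_one, pow_zero, pow_two]
    linarith
  | succ j ih =>
    obtain ⟨hA, hB⟩ := ih
    refine ⟨fun Z => ?_, fun P Q hP hQ => ?_⟩
    · have hs : (Z * Zᵀ).IsSymm := Matrix.isSymm_mul_transpose_self Z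
      have hs' : (Zᵀ * Z).IsSymm := Matrix.isSymm_transpose_mul_self Z
      have h1 := hA (Z * Z)
      have e1 : Z * Z * (Z * Z)ᵀ = Z * ((Z * Zᵀ) * Zᵀ) := by
        simp only [transpose_mul, Matrix.mul_assoc]
      rw [e1, trace_mul_pow_comm Z (Z * Zᵀ * Zᵀ)] at h1
      have h2 := hB (Z * Zᵀ) (Zᵀ * Z) hs hs'
      have e2 : Z * Zᵀ * Zᵀ * Z = (Z * Zᵀ) * (Zᵀ * Z) := by simp only [Matrix.mul_assoc]
      rw [e2] at h1
      have h3 := two_mul_trace_mul_le ((Z * Zᵀ) ^ 2 ^ j) ((Zᵀ * Z) ^ 2 ^ j)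
      rw [transpose_pow, transpose_pow, hs.eq, hs'.eq, ← pow_add, ← pow_add, ← two_mul,
        ← pow_succ', trace_mul_pow_comm Zᵀ Z] at h3
      rw [← pow_two, ← pow_mul, ← pow_succ'] at h1
      linarith
    · have h1 := hA (P * Q)
      have e1 : P * Q * (P * Q)ᵀ = P * (Q * Q * P) := by
        simp only [transpose_mul, hP.eq, hQ.eq, Matrix.mul_assoc]
      have e2 : Q * Q * P * P = (Q * Q) * (P * P) := by simp only [Matrix.mul_assoc]
      rw [e1, trace_mul_pow_comm P (Q * Q * P), e2, trace_mul_pow_comm (Q * Q) (P * P)] at h1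
      have h2 := hB (P * P) (Q * Q) (by rw [IsSymm, transpose_mul, hP.eq])
        (by rw [IsSymm, transpose_mul, hQ.eq])
      simp only [← pow_two, ← pow_mul, ← pow_succ'] at h1 h2
      exact h1.trans h2

end TraceInequalities

/-! ### The Lie–Trotter product formula. -/

section LieTrotter

variable {𝔸 : Type*} [NormedRing 𝔸] [NormOneClass 𝔸]

theorem norm_pow_sub_pow_le (u v : 𝔸) {K : ℝ} (hu : ‖u‖ ≤ K) (hv : ‖v‖ ≤ K) (hK : 1 ≤ K) (N : ℕ) :
    ‖u ^ N - v ^ N‖ ≤ N * ‖u - v‖ * K ^ N := by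
  have hK0 : 0 ≤ K := by linarith
  induction N with
  | zero => simp
  | succ N ih =>
    have e : u ^ (N + 1) - v ^ (N + 1) = (u ^ N - v ^ N) * u + v ^ N * (u - v) := by
      rw [pow_succ, pow_succ]; noncomm_ring
    have h1 : ‖(u ^ N - v ^ N) * u‖ ≤ (N * ‖u - v‖ * K ^ N) * K :=
      (norm_mul_le _ _).trans (by gcongr)
    have h2 : ‖v ^ N * (u - v)‖ ≤ K ^ (N + 1) * ‖u - v‖ := by
      refine (norm_mul_le _ _).trans ?_
      have : ‖v ^ N‖ ≤ K ^ N := (norm_pow_le _ _).trans (by gcongr)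
      have : K ^ N ≤ K ^ (N + 1) := pow_le_pow_right₀ hK (Nat.le_succ N)
      gcongr
      linarith
    rw [e]
    refine (norm_add_le _ _).trans ((add_le_add h1 h2).trans (le_of_eq ?_))
    push_cast
    ring

open Filter Topology in
-- Curves through `1` with a common derivative differ by `o(1/N)` at time `1/N`. Both have norm at
-- most `1 + c/N` there, so telescoping the `N`-th powers costs only a factor `N · exp c`.
theorem tendsto_pow_sub_pow_of_hasDerivAt [NormedAlgebra ℝ 𝔸] {U V : ℝ → 𝔸} {D : 𝔸}
    (hU : HasDerivAt U D 0) (hV : HasDerivAt V D 0) (hU0 : U 0 = 1) (hV0 : V 0 = 1) :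
    Tendsto (fun N : ℕ => U ((N : ℝ)⁻¹) ^ N - V ((N : ℝ)⁻¹) ^ N) atTop (𝓝 0) := by
  have ht : Tendsto (fun N : ℕ => (N : ℝ)⁻¹) atTop (𝓝 0) := tendsto_inv_atTop_nhds_zero_nat
  set c : ℝ := ‖D‖ + 1 with hc
  have bound : ∀ W : ℝ → 𝔸, HasDerivAt W D 0 → W 0 = 1 →
      ∀ᶠ t in 𝓝 (0 : ℝ), ‖W t‖ ≤ 1 + c * |t| := by
    intro W hW hW0
    have h := hW.isLittleO
    filter_upwards [h.def one_pos] with t ht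
    simp only [hW0, sub_zero, one_mul, Real.norm_eq_abs] at ht
    have e : W t = (W t - 1 - t • D) + (1 + t • D) := by abel
    rw [e]
    refine (norm_add_le _ _).trans ?_
    have h2 : ‖1 + t • D‖ ≤ 1 + |t| * ‖D‖ := by
      refine (norm_add_le _ _).trans ?_
      rw [norm_one, norm_smul, Real.norm_eq_abs]
    rw [hc]
    linarith
  have hD : HasDerivAt (U - V) 0 0 := by simpa using hU.sub hV
  rw [Metric.tendsto_nhds]
  intro δ hδ
  -- This tolerance absorbs the later factor `exp c` and leaves `δ / 2`.
  have hsmall := hD.isLittleO.def (c := δ / (2 * Real.exp c)) (by positivity)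
  filter_upwards [ht.eventually hsmall, ht.eventually (bound U hU hU0),
    ht.eventually (bound V hV hV0), eventually_gt_atTop 0] with N h1 h2 h3 hN
  have hN' : (0 : ℝ) < N := by exact_mod_cast hN
  have hc0 : 0 ≤ c := by positivity
  simp only [Pi.sub_apply, hU0, hV0, sub_zero, sub_self, smul_zero, Real.norm_eq_abs] at h1
  rw [abs_of_pos (inv_pos.2 hN')] at h1 h2 h3
  have h4 := norm_pow_sub_pow_le _ _ h2 h3 (by
    have : 0 ≤ c * (N : ℝ)⁻¹ := by positivity
    linarith) N
  have h5 : (1 + c * (N : ℝ)⁻¹) ^ N ≤ Real.exp c := by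
    have : 1 + c * (N : ℝ)⁻¹ ≤ Real.exp (c * (N : ℝ)⁻¹) := by
      linarith [Real.add_one_le_exp (c * (N : ℝ)⁻¹)]
    calc (1 + c * (N : ℝ)⁻¹) ^ N ≤ Real.exp (c * (N : ℝ)⁻¹) ^ N := by gcongr
      _ = Real.exp c := by rw [← Real.exp_nat_mul]; congr 1; field_simp
  rw [dist_zero_right]
  calc _ ≤ _ := h4
    _ ≤ N * (δ / (2 * Real.exp c) * (N : ℝ)⁻¹) * Real.exp c := by gcongr
    _ = δ / 2 := by field_simp
    _ < δ := by linarith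

open Filter Topology in
theorem tendsto_lie_trotter [NormedAlgebra ℝ 𝔸] [CompleteSpace 𝔸] (X Y : 𝔸) :
    Tendsto (fun N : ℕ => (NormedSpace.exp ((N : ℝ)⁻¹ • X) * NormedSpace.exp ((N : ℝ)⁻¹ • Y)) ^ N)
      atTop (𝓝 (NormedSpace.exp (X + Y))) := by
  let _ : NormedAlgebra ℚ 𝔸 := NormedAlgebra.restrictScalars ℚ ℝ 𝔸
  have hX := hasDerivAt_exp_smul_const (𝕂 := ℝ) X (0 : ℝ)
  have hY := hasDerivAt_exp_smul_const (𝕂 := ℝ) Y (0 : ℝ)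
  have hS := hasDerivAt_exp_smul_const (𝕂 := ℝ) (X + Y) (0 : ℝ)
  have hXY := hX.mul hY
  simp only [zero_smul, NormedSpace.exp_zero, one_mul, mul_one] at hXY hS
  have h := tendsto_pow_sub_pow_of_hasDerivAt hXY hS (by simp) (by simp)
  have h2 : Tendsto (fun N : ℕ => (NormedSpace.exp ((N : ℝ)⁻¹ • (X + Y))) ^ N) atTop
      (𝓝 (NormedSpace.exp (X + Y))) := by
    refine tendsto_const_nhds.congr' ?_
    filter_upwards [eventually_gt_atTop 0] with N hN
    rw [← NormedSpace.exp_nsmul, ← Nat.cast_smul_eq_nsmul ℝ, smul_smul, mul_inv_cancel₀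
      (by positivity), one_smul]
  simpa using h.add h2

end LieTrotter

/-! ### The Golden–Thompson inequality. -/

section GoldenThompson

open Matrix Filter Topology
open scoped Matrix.Norms.Operator

/-- The **Golden–Thompson inequality** for real symmetric matrices. -/
theorem trace_exp_add_le {κ : Type*} [Fintype κ] [DecidableEq κ] {X Y : Matrix κ κ ℝ}
    (hX : X.IsSymm) (hY : Y.IsSymm) :
    (NormedSpace.exp (X + Y)).trace ≤ (NormedSpace.exp X * NormedSpace.exp Y).trace := by
  -- The limit formula needs `‖1‖ = 1`, which fails for matrices of size zero.
  cases isEmpty_or_nonempty κ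
  · simp [Matrix.trace]
  -- Along `N = 2 ^ k` the dyadic trace inequality bounds every term by the same right-hand side.
  have h1 := (tendsto_lie_trotter X Y).comp (tendsto_pow_atTop_atTop_of_one_lt one_lt_two)
  have h2 := ((continuous_id.matrix_trace (R := ℝ)).tendsto _).comp h1
  refine le_of_tendsto' h2 fun k => ?_
  simp only [Function.comp, id]
  refine ((trace_dyadic_pow_le k).2 _ _ (hX.smul _).exp (hY.smul _).exp).trans (le_of_eq ?_)
  have e : ∀ Z : Matrix κ κ ℝ,
      NormedSpace.exp (((2 ^ k : ℕ) : ℝ)⁻¹ • Z) ^ 2 ^ k = NormedSpace.exp Z := by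
    intro Z
    rw [← Matrix.exp_nsmul, ← Nat.cast_smul_eq_nsmul ℝ, smul_smul, mul_inv_cancel₀
      (by positivity), one_smul]
  rw [e, e]

end GoldenThompson

/-! ### The matrix exponential and the matrix Chernoff bound. -/

section MatrixChernoff

open Matrix
open scoped Matrix.Norms.Operator

variable {κ : Type*} [Fintype κ] [DecidableEq κ]

theorem isHermitian_eq_conj_diagonal {H : Matrix κ κ ℝ} (hH : H.IsHermitian) :
    ∃ U : Matrix κ κ ℝ, U * Uᵀ = 1 ∧ Uᵀ * U = 1 ∧ H = U * diagonal hH.eigenvalues * Uᵀ := by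
  refine ⟨hH.eigenvectorUnitary, ?_, ?_, ?_⟩
  · exact Unitary.coe_mul_star_self hH.eigenvectorUnitary
  · exact Unitary.coe_star_mul_self hH.eigenvectorUnitary
  · exact hH.spectral_theorem

theorem trace_exp_eq_sum_eigenvalues {H : Matrix κ κ ℝ} (hH : H.IsHermitian) :
    (NormedSpace.exp H).trace = ∑ i, Real.exp (hH.eigenvalues i) := by
  obtain ⟨U, h1, h2, h3⟩ := isHermitian_eq_conj_diagonal hH
  have hinv : U⁻¹ = Uᵀ := Matrix.inv_eq_right_inv h1
  have hu : IsUnit U := ⟨⟨U, Uᵀ, h1, h2⟩, rfl⟩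
  have e : NormedSpace.exp H = U * diagonal (NormedSpace.exp hH.eigenvalues) * U⁻¹ := by
    rw [← Matrix.exp_diagonal, ← Matrix.exp_conj _ _ hu, hinv, ← h3]
  rw [e, Matrix.trace_mul_comm, ← Matrix.mul_assoc, hinv, h2, Matrix.one_mul, trace_diagonal]
  refine Finset.sum_congr rfl fun i _ => ?_
  rw [Pi.exp_def, Real.exp_eq_exp_ℝ]

theorem dotProduct_mulVec_le_of_eigenvalues_le {H : Matrix κ κ ℝ} (hH : H.IsHermitian) {t : ℝ}
    (ht : ∀ i, hH.eigenvalues i ≤ t) (x : κ → ℝ) : x ⬝ᵥ H *ᵥ x ≤ t * (x ⬝ᵥ x) := by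
  obtain ⟨U, h1, -, h3⟩ := isHermitian_eq_conj_diagonal hH
  have hd : (diagonal fun i => t - hH.eigenvalues i).PosSemidef :=
    PosSemidef.diagonal fun i => sub_nonneg.2 (ht i)
  have h := (hd.mul_mul_conjTranspose_same U).dotProduct_mulVec_nonneg x
  have e : U * (diagonal fun i => t - hH.eigenvalues i) * Uᴴ = t • 1 - H := by
    have e' : (diagonal fun i => t - hH.eigenvalues i)
        = t • (1 : Matrix κ κ ℝ) - diagonal hH.eigenvalues := by
      rw [← diagonal_one, ← diagonal_smul, diagonal_sub]
      simp
    rw [e', Matrix.mul_sub, Matrix.sub_mul, conjTranspose_eq_transpose_of_trivial, ← h3,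
      Matrix.mul_smul, Matrix.mul_one, Matrix.smul_mul, h1]
  rw [e, star_trivial, Matrix.sub_mulVec, smul_mulVec, one_mulVec, dotProduct_sub,
    dotProduct_smul, smul_eq_mul] at h
  linarith

theorem dotProduct_mulVec_le_of_trace_exp_le {H : Matrix κ κ ℝ} (hH : H.IsHermitian) {t : ℝ}
    (ht : (NormedSpace.exp H).trace ≤ Real.exp t) (x : κ → ℝ) :
    x ⬝ᵥ H *ᵥ x ≤ t * (x ⬝ᵥ x) := by
  refine dotProduct_mulVec_le_of_eigenvalues_le hH (fun i => ?_) x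
  rw [trace_exp_eq_sum_eigenvalues hH] at ht
  exact Real.exp_le_exp.1 ((Finset.single_le_sum (f := fun i => Real.exp (hH.eigenvalues i))
    (fun i _ => (Real.exp_pos _).le) (Finset.mem_univ i)).trans ht)

theorem trace_exp_nonneg {H : Matrix κ κ ℝ} (hH : H.IsHermitian) :
    0 ≤ (NormedSpace.exp H).trace := by
  rw [trace_exp_eq_sum_eigenvalues hH]
  positivity

/-- All positive powers of `P` equal `P`, so the series is `exp t • P` with its constant term
corrected by `1 - P`. -/
theorem exp_smul_of_idempotent {P : Matrix κ κ ℝ} (hP : P * P = P) (t : ℝ) :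
    NormedSpace.exp (t • P) = 1 + (Real.exp t - 1) • P := by
  have hpow : ∀ k : ℕ, P ^ (k + 1) = P := by
    intro k
    induction k with
    | zero => simp
    | succ k ih => rw [pow_succ, ih, hP]
  have h1 : HasSum (fun k : ℕ => ((k.factorial : ℝ)⁻¹ • t ^ k) • P) (Real.exp t • P) := by
    rw [Real.exp_eq_exp_ℝ]
    exact (NormedSpace.exp_series_hasSum_exp' (𝕂 := ℝ) t).smul_const P
  have h2 : HasSum (fun k : ℕ => if k = 0 then 1 - P else 0) (1 - P) := hasSum_ite_eq 0 _
  have h3 := NormedSpace.exp_series_hasSum_exp' (𝕂 := ℝ) (t • P)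
  have e : (fun k : ℕ => (k.factorial : ℝ)⁻¹ • (t • P) ^ k)
      = fun k : ℕ => ((k.factorial : ℝ)⁻¹ • t ^ k) • P + if k = 0 then 1 - P else 0 := by
    funext k
    cases k with
    | zero => simp
    | succ k => simp [smul_pow, hpow, smul_smul]
  rw [e] at h3
  refine (h3.unique (h1.add h2)).trans ?_
  rw [sub_smul, one_smul]
  abel

variable {ι : Type*} [Fintype ι]

/-- Golden–Thompson splits off the factor of one new draw. That factor is affine in the projection,
and its mean is a scalar matrix. -/
theorem sum_trace_exp_sub_le {p : ι → ℝ} (hp : ∀ i, 0 ≤ p i) (hp1 : ∑ i, p i = 1)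
    {P : ι → Matrix κ κ ℝ} (hPs : ∀ i, (P i).IsSymm) (hPi : ∀ i, P i * P i = P i) {c : ℝ}
    (hc : ∑ i, p i • P i = c • 1) {X : Matrix κ κ ℝ} (hX : X.IsSymm) (θ : ℝ) :
    ∑ i, p i * (NormedSpace.exp (X - θ • P i)).trace
      ≤ (1 - (1 - Real.exp (-θ)) * c) * (NormedSpace.exp X).trace := by
  have hstep : ∀ i, p i * (NormedSpace.exp (X - θ • P i)).trace
      ≤ p i * (NormedSpace.exp X).trace
        - (1 - Real.exp (-θ)) * (NormedSpace.exp X * (p i • P i)).trace := by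
    intro i
    have h := trace_exp_add_le hX ((hPs i).smul (-θ))
    rw [exp_smul_of_idempotent (hPi i), Matrix.mul_add, Matrix.mul_one, trace_add,
      Matrix.mul_smul, trace_smul, smul_eq_mul, neg_smul, ← sub_eq_add_neg] at h
    rw [Matrix.mul_smul, trace_smul, smul_eq_mul]
    nlinarith [mul_le_mul_of_nonneg_left h (hp i)]
  refine (Finset.sum_le_sum fun i _ => hstep i).trans (le_of_eq ?_)
  rw [Finset.sum_sub_distrib, ← Finset.sum_mul, hp1, ← Finset.mul_sum, ← trace_sum,
    ← Matrix.mul_sum, hc, Matrix.mul_smul, Matrix.mul_one, trace_smul, smul_eq_mul]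
  ring

theorem sum_prod_trace_exp_le {p : ι → ℝ} (hp : ∀ i, 0 ≤ p i) (hp1 : ∑ i, p i = 1)
    {P : ι → Matrix κ κ ℝ} (hPs : ∀ i, (P i).IsSymm) (hPi : ∀ i, P i * P i = P i) {c : ℝ}
    (hc : ∑ i, p i • P i = c • 1) {θ : ℝ} (hr : 0 ≤ 1 - (1 - Real.exp (-θ)) * c) (q : ℕ) :
    ∑ ω : Fin q → ι, (∏ j, p (ω j)) * (NormedSpace.exp (-(θ • ∑ j, P (ω j)))).trace
      ≤ (1 - (1 - Real.exp (-θ)) * c) ^ q * Fintype.card κ := by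
  induction q with
  | zero => simp
  | succ q ih =>
    rw [← (Fin.consEquiv fun _ : Fin (q + 1) => ι).sum_comp, Fintype.sum_prod_type_right]
    have hstep : ∀ ω : Fin q → ι,
        ∑ i, (∏ j, p ((Fin.consEquiv fun _ : Fin (q + 1) => ι) (i, ω) j))
          * (NormedSpace.exp (-(θ • ∑ j, P ((Fin.consEquiv fun _ : Fin (q + 1) => ι) (i, ω) j)))).trace
        ≤ (1 - (1 - Real.exp (-θ)) * c)
          * ((∏ j, p (ω j)) * (NormedSpace.exp (-(θ • ∑ j, P (ω j)))).trace) := by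
      intro ω
      have hX : (-(θ • ∑ j, P (ω j))).IsSymm := by
        rw [IsSymm, transpose_neg, transpose_smul, transpose_sum]
        simp only [(hPs _).eq]
      have h := mul_le_mul_of_nonneg_left (sum_trace_exp_sub_le hp hp1 hPs hPi hc hX θ)
        (Finset.prod_nonneg fun j (_ : j ∈ Finset.univ) => hp (ω j))
      rw [Finset.mul_sum] at h
      refine (le_of_eq (Finset.sum_congr rfl fun i _ => ?_)).trans (h.trans (le_of_eq (by ring)))
      simp only [Fin.consEquiv_apply, Fin.prod_univ_succ, Fin.sum_univ_succ, Fin.cons_zero,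
        Fin.cons_succ]
      rw [smul_add, neg_add, add_comm (-(θ • P i)), ← sub_eq_add_neg]
      ring
    refine (Finset.sum_le_sum fun ω _ => hstep ω).trans ?_
    rw [← Finset.mul_sum, pow_succ', mul_assoc]
    gcongr

open Classical in
/-- The **matrix Chernoff inequality**, lower tail, for independent random projections. -/
theorem sum_prod_not_le (q : ℕ) {p : ι → ℝ} (hp : ∀ i, 0 ≤ p i) (hp1 : ∑ i, p i = 1)
    {P : ι → Matrix κ κ ℝ} (hPs : ∀ i, (P i).IsSymm) (hPi : ∀ i, P i * P i = P i) {c : ℝ}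
    (hc : ∑ i, p i • P i = c • 1) (hc0 : 0 ≤ c) (hc1 : c ≤ 1) {δ : ℝ} (hδ : 0 < δ) :
    ∑ ω : Fin q → ι with
        ¬ ∀ x : κ → ℝ, (1 - δ) * (q * c) * (x ⬝ᵥ x) ≤ x ⬝ᵥ (∑ j, P (ω j)) *ᵥ x,
      ∏ j, p (ω j) ≤ Fintype.card κ * Real.exp (-(δ ^ 2 / 2) * (q * c)) := by
  set r : ℝ := 1 - (1 - Real.exp (-δ)) * c with hr_def
  have hexp0 := Real.exp_pos (-δ)
  -- Uses `(1 - δ + δ²/2)(1 + δ + δ²/2) = 1 + δ⁴/4 ≥ 1`.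
  have hexp : Real.exp (-δ) ≤ 1 - δ + δ ^ 2 / 2 := by
    rw [Real.exp_neg, inv_le_iff_one_le_mul₀ (Real.exp_pos _)]
    have h := Real.quadratic_le_exp_of_nonneg hδ.le
    nlinarith [sq_nonneg (1 - δ), sq_nonneg (δ ^ 2)]
  have hr : 0 ≤ r := by nlinarith
  have hr1 : r ≤ Real.exp (-(δ - δ ^ 2 / 2) * c) := by
    refine le_trans ?_ (Real.add_one_le_exp _)
    nlinarith
  set s : ℝ := (1 - δ) * (q * c) with hs
  -- Taking `θ = δ` is not optimal, but the exponents combine to `δ(1 - δ) - (δ - δ²/2) = -δ²/2`,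
  -- times `q c`.
  have hsum := sum_prod_trace_exp_le hp hp1 hPs hPi hc (θ := δ) hr q
  have hherm : ∀ ω : Fin q → ι, (-(δ • ∑ j, P (ω j))).IsHermitian := by
    intro ω
    rw [IsHermitian, conjTranspose_eq_transpose_of_trivial, transpose_neg, transpose_smul,
      transpose_sum]
    simp only [(hPs _).eq]
  have hbad : ∀ ω : Fin q → ι,
      (¬ ∀ x : κ → ℝ, s * (x ⬝ᵥ x) ≤ x ⬝ᵥ (∑ j, P (ω j)) *ᵥ x) →
      1 ≤ Real.exp (δ * s) * (NormedSpace.exp (-(δ • ∑ j, P (ω j)))).trace := by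
    intro ω hω
    by_contra hlt
    refine hω fun x => ?_
    have h1 : (NormedSpace.exp (-(δ • ∑ j, P (ω j)))).trace ≤ Real.exp (-(δ * s)) := by
      rw [Real.exp_neg, ← one_div, le_div_iff₀' (Real.exp_pos _)]
      exact (not_le.1 hlt).le
    have h2 := dotProduct_mulVec_le_of_trace_exp_le (hherm ω) h1 x
    rw [neg_mulVec, smul_mulVec, dotProduct_neg, dotProduct_smul, smul_eq_mul] at h2
    have h3 : δ * (s * (x ⬝ᵥ x)) ≤ δ * (x ⬝ᵥ (∑ j, P (ω j)) *ᵥ x) := by linarith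
    exact le_of_mul_le_mul_left h3 hδ
  have hprod : ∀ ω : Fin q → ι, 0 ≤ ∏ j, p (ω j) := fun ω => Finset.prod_nonneg fun j _ => hp _
  calc _ ≤ ∑ ω : Fin q → ι with
        ¬ ∀ x : κ → ℝ, s * (x ⬝ᵥ x) ≤ x ⬝ᵥ (∑ j, P (ω j)) *ᵥ x,
        Real.exp (δ * s) * ((∏ j, p (ω j)) * (NormedSpace.exp (-(δ • ∑ j, P (ω j)))).trace) := by
        refine Finset.sum_le_sum fun ω hω => ?_
        have := mul_le_mul_of_nonneg_left (hbad ω (Finset.mem_filter.1 hω).2) (hprod ω)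
        linarith
    _ ≤ ∑ ω : Fin q → ι,
        Real.exp (δ * s) * ((∏ j, p (ω j)) * (NormedSpace.exp (-(δ • ∑ j, P (ω j)))).trace) :=
        Finset.sum_le_sum_of_subset_of_nonneg (Finset.filter_subset _ _) fun ω _ _ =>
          mul_nonneg (Real.exp_pos _).le (mul_nonneg (hprod ω) (trace_exp_nonneg (hherm ω)))
    _ ≤ Real.exp (δ * s) * (Real.exp (-(δ - δ ^ 2 / 2) * c) ^ q * Fintype.card κ) := by
        rw [← Finset.mul_sum]
        gcongr
        exact hsum.trans (by gcongr)
    _ = _ := by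
        rw [← Real.exp_nat_mul, ← mul_assoc, ← Real.exp_add, mul_comm, hs]
        congr 2
        ring

end MatrixChernoff

/-! ### Quadratic forms and the frame condition. -/

section QuadraticForms

open Matrix

variable {n : ℕ} {ι : Type*} [Fintype ι]

theorem dotProduct_outer_mulVec (v : EuclideanSpace ℝ (Fin n)) (x : Fin n → ℝ) :
    x ⬝ᵥ outer v *ᵥ x = (v.ofLp ⬝ᵥ x) ^ 2 := by
  have e : outer v = vecMulVec v.ofLp v.ofLp := rfl
  rw [e, vecMulVec_mulVec]
  simp [dotProduct_comm x, pow_two]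

theorem dotProduct_frameMatrix_mulVec (Φ : ι → EuclideanSpace ℝ (Fin n)) (x : Fin n → ℝ) :
    x ⬝ᵥ frameMatrix Φ *ᵥ x = ∑ i, ((Φ i).ofLp ⬝ᵥ x) ^ 2 := by
  rw [frameMatrix, ← Matrix.mulVec_mulVec, Matrix.dotProduct_mulVec, Matrix.vecMul_transpose]
  simp [dotProduct, analysisMatrix, mulVec, pow_two]

theorem abs_inner_sq (v x : EuclideanSpace ℝ (Fin n)) :
    |inner ℝ x v| ^ 2 = (v.ofLp ⬝ᵥ x.ofLp) ^ 2 := by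
  rw [sq_abs]
  simp [PiLp.inner_apply, dotProduct]

/-- A finite family whose frame matrix dominates a positive multiple of that of a frame is a
frame. -/
theorem IsFrame.of_le {ι' : Type*} [Fintype ι'] {Φ : ι → EuclideanSpace ℝ (Fin n)}
    (hΦ : IsFrame Φ) {Ψ : ι' → EuclideanSpace ℝ (Fin n)} {c : ℝ} (hc : 0 < c)
    (h : ∀ x, c * (x ⬝ᵥ frameMatrix Φ *ᵥ x) ≤ x ⬝ᵥ frameMatrix Ψ *ᵥ x) : IsFrame Ψ := by
  obtain ⟨α, β, hα, -, hαβ⟩ := hΦ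
  -- Cauchy–Schwarz already gives the upper bound `∑ ‖Ψ i‖²`; adding `c * α` only ensures that the
  -- bounds are ordered.
  refine ⟨c * α, c * α + ∑ i, ‖Ψ i‖ ^ 2, by positivity,
    le_add_of_nonneg_right (Finset.sum_nonneg fun _ _ => by positivity), fun x => ⟨?_, ?_⟩⟩
  · have h1 := (hαβ x).1
    have h2 := h x.ofLp
    simp only [dotProduct_frameMatrix_mulVec] at h2
    simp only [abs_inner_sq] at h1 ⊢
    nlinarith [mul_le_mul_of_nonneg_left h1 hc.le]
  · have h1 : ∑ i, |inner ℝ x (Ψ i)| ^ 2 ≤ ∑ i, ‖x‖ ^ 2 * ‖Ψ i‖ ^ 2 := by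
      refine Finset.sum_le_sum fun i _ => ?_
      rw [← mul_pow]
      exact pow_le_pow_left₀ (abs_nonneg _) (abs_real_inner_le_norm x (Ψ i)) 2
    rw [← Finset.mul_sum] at h1
    nlinarith [mul_nonneg (mul_pos hc hα).le (sq_nonneg ‖x‖)]

end QuadraticForms

/-! ### Weights, selected indices and `χ`. -/

section AlgorithmOutput

open Matrix

variable {n m : ℕ} (Φ : Fin m → EuclideanSpace ℝ (Fin n))

theorem sum_weight_foldl (q : ℕ) (f : Fin m → ℝ) (l : List (Fin m)) (st : SparsState n m) :
    ∑ i, (l.foldl (stepState Φ q) st).weight i * f i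
      = ∑ i, st.weight i * f i
        + (l.map fun i => ((q : ℝ) * samplingProb Φ i)⁻¹ * f i).sum := by
  induction l generalizing st with
  | nil => simp
  | cons a l ih =>
    rw [List.foldl_cons, ih, List.map_cons, List.sum_cons, ← add_assoc]
    congr 1
    have e : ∀ i, (stepState Φ q st a).weight i * f i
        = st.weight i * f i + if i = a then ((q : ℝ) * samplingProb Φ i)⁻¹ * f i else 0 := by
      intro i
      by_cases hi : i = a
      · subst hi; simp [stepState]; ring
      · simp [stepState, hi]
    simp_rw [e, Finset.sum_add_distrib]
    simp

theorem sum_weights_mul {q : ℕ} (ω : Fin q → Fin m) (f : Fin m → ℝ) :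
    ∑ i, weights Φ ω i * f i = ∑ j, ((q : ℝ) * samplingProb Φ (ω j))⁻¹ * f (ω j) := by
  rw [weights, runAlgorithm, sum_weight_foldl, List.map_ofFn, List.sum_ofFn]
  simp [initState]

theorem foldl_weight_support (q : ℕ) (l : List (Fin m)) (st : SparsState n m)
    (hst : ∀ i, st.weight i ≠ 0 → i ∈ st.selected) (i : Fin m)
    (hi : (l.foldl (stepState Φ q) st).weight i ≠ 0) :
    i ∈ (l.foldl (stepState Φ q) st).selected := by
  induction l generalizing st with
  | nil => exact hst i hi
  | cons a l ih =>
    refine ih (stepState Φ q st a) (fun k hk => ?_) hi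
    by_cases hka : k = a
    · subst hka
      by_cases h : k ∈ st.selected <;> simp [stepState, h]
    · have : k ∈ st.selected := hst k (by simpa [stepState, hka] using hk)
      by_cases h : a ∈ st.selected <;> simp [stepState, h, this]

theorem mem_selected_of_weights_ne_zero {q : ℕ} (ω : Fin q → Fin m) {i : Fin m}
    (hi : weights Φ ω i ≠ 0) : i ∈ (runAlgorithm Φ ω).selected :=
  foldl_weight_support Φ q _ _ (by simp [initState]) i hi

variable {Φ}

theorem weights_nonneg (hΦ : IsFrame Φ) {q : ℕ} (ω : Fin q → Fin m) (i : Fin m) :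
    0 ≤ weights Φ ω i := by
  have h := sum_weights_mul Φ ω fun k => if k = i then 1 else 0
  simp only [mul_ite, mul_one, mul_zero, Finset.sum_ite_eq', Finset.mem_univ, if_true] at h
  rw [h]
  refine Finset.sum_nonneg fun j _ => ?_
  have : 0 ≤ samplingProb Φ (ω j) := div_nonneg (leverage_nonneg hΦ _) (Nat.cast_nonneg n)
  split_ifs <;> positivity

theorem dotProduct_frameMatrix_sparsified {q : ℕ} (ω : Fin q → Fin m) (x : Fin n → ℝ) :
    x ⬝ᵥ frameMatrix (sparsified Φ ω) *ᵥ x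
      = ∑ i ∈ (runAlgorithm Φ ω).selected, ((Φ i).ofLp ⬝ᵥ x) ^ 2 := by
  rw [dotProduct_frameMatrix_mulVec]
  exact Finset.sum_coe_sort _ fun i => ((Φ i).ofLp ⬝ᵥ x) ^ 2

theorem dotProduct_frameMatrix_sparsified_le {q : ℕ} (ω : Fin q → Fin m) (x : Fin n → ℝ) :
    x ⬝ᵥ frameMatrix (sparsified Φ ω) *ᵥ x ≤ x ⬝ᵥ frameMatrix Φ *ᵥ x := by
  rw [dotProduct_frameMatrix_sparsified, dotProduct_frameMatrix_mulVec]
  exact Finset.sum_le_sum_of_subset_of_nonneg (Finset.subset_univ _) fun _ _ _ => sq_nonneg _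

theorem chi_nonneg {q : ℕ} (ω : Fin q → Fin m) : 0 ≤ chi Φ ω :=
  Real.sInf_nonneg fun _ h => h.1.le

theorem dotProduct_sum_smul_outer (w : Fin m → ℝ) (x : Fin n → ℝ) :
    x ⬝ᵥ (∑ i, w i • outer (Φ i)) *ᵥ x = ∑ i, w i * ((Φ i).ofLp ⬝ᵥ x) ^ 2 := by
  rw [Matrix.sum_mulVec, dotProduct_sum]
  refine Finset.sum_congr rfl fun i _ => ?_
  rw [smul_mulVec, dotProduct_smul, dotProduct_outer_mulVec, smul_eq_mul]

/-- Each admissible `γ` gives this inequality with `γ` in place of `χ`, and it survives passage to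
the infimum. -/
theorem sum_weights_sq_le (hΦ : IsFrame Φ) {q : ℕ} (ω : Fin q → Fin m) (x : Fin n → ℝ) :
    ∑ i, weights Φ ω i ^ 2 * ((Φ i).ofLp ⬝ᵥ x) ^ 2
      ≤ chi Φ ω * ∑ i, weights Φ ω i * ((Φ i).ofLp ⬝ᵥ x) ^ 2 := by
  have hw := weights_nonneg hΦ ω
  set w := weights Φ ω with hw_def
  set b := ∑ i, w i ^ 2 * ((Φ i).ofLp ⬝ᵥ x) ^ 2 with hb
  set a := ∑ i, w i * ((Φ i).ofLp ⬝ᵥ x) ^ 2 with ha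
  have hmem : ∀ γ ∈ {γ : ℝ | 0 < γ ∧ (∑ i, (w i * (γ - w i)) • outer (Φ i)).PosSemidef},
      b ≤ γ * a := by
    rintro γ ⟨-, hγ⟩
    have h := hγ.dotProduct_mulVec_nonneg x
    rw [star_trivial, dotProduct_sum_smul_outer] at h
    rw [ha, hb, Finset.mul_sum, ← sub_nonneg, ← Finset.sum_sub_distrib]
    refine h.trans (le_of_eq (Finset.sum_congr rfl fun i _ => by ring))
  -- This value exceeds every weight, so the admissible set is nonempty and its `sInf` is a true
  -- infimum.
  have hne : (1 + ∑ i, w i) ∈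
      {γ : ℝ | 0 < γ ∧ (∑ i, (w i * (γ - w i)) • outer (Φ i)).PosSemidef} := by
    have hsum : 0 ≤ ∑ i, w i := Finset.sum_nonneg fun i _ => hw i
    refine ⟨by positivity, Matrix.posSemidef_sum _ fun i _ => ?_⟩
    have hi : w i ≤ ∑ i, w i := Finset.single_le_sum (fun k _ => hw k) (Finset.mem_univ i)
    exact (Matrix.posSemidef_vecMulVec_self_star (Φ i).ofLp).smul
      (mul_nonneg (hw i) (by linarith))
  have ha0 : 0 ≤ a := Finset.sum_nonneg fun i _ => mul_nonneg (hw i) (sq_nonneg _)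
  rcases ha0.eq_or_lt with h0 | hpos
  · simpa [← h0] using hmem _ hne
  · rw [← div_le_iff₀ hpos]
    exact le_csInf ⟨_, hne⟩ fun γ hγ => (div_le_iff₀ hpos).2 (hmem γ hγ)

/-- Weights vanish off the selected set. With `a` the left side and `s` the quadratic form of `S_s`,
Cauchy–Schwarz gives `a² ≤ (∑ w² ⟨φ, x⟩²) s ≤ χ a s`; then `a` cancels. -/
theorem sum_weights_le_chi_mul (hΦ : IsFrame Φ) {q : ℕ} (ω : Fin q → Fin m) (x : Fin n → ℝ) :
    ∑ i, weights Φ ω i * ((Φ i).ofLp ⬝ᵥ x) ^ 2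
      ≤ chi Φ ω * (x ⬝ᵥ frameMatrix (sparsified Φ ω) *ᵥ x) := by
  rw [dotProduct_frameMatrix_sparsified]
  set T := (runAlgorithm Φ ω).selected
  have hS0 : 0 ≤ ∑ i ∈ T, ((Φ i).ofLp ⬝ᵥ x) ^ 2 := Finset.sum_nonneg fun _ _ => sq_nonneg _
  have hχ := chi_nonneg (Φ := Φ) ω
  have hW := sum_weights_sq_le hΦ ω x
  have e1 : ∑ i, weights Φ ω i * ((Φ i).ofLp ⬝ᵥ x) ^ 2
      = ∑ i ∈ T, (weights Φ ω i * ((Φ i).ofLp ⬝ᵥ x)) * ((Φ i).ofLp ⬝ᵥ x) := by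
    rw [← Finset.sum_subset (Finset.subset_univ T)]
    · exact Finset.sum_congr rfl fun i _ => by ring
    · intro i _ hi
      rw [not_not.1 (mt (mem_selected_of_weights_ne_zero Φ ω) hi), zero_mul]
  have hCS := Finset.sum_mul_sq_le_sq_mul_sq T
    (fun i => weights Φ ω i * ((Φ i).ofLp ⬝ᵥ x)) (fun i => (Φ i).ofLp ⬝ᵥ x)
  rw [← e1] at hCS
  have h2 : ∑ i ∈ T, (weights Φ ω i * ((Φ i).ofLp ⬝ᵥ x)) ^ 2
      ≤ ∑ i, weights Φ ω i ^ 2 * ((Φ i).ofLp ⬝ᵥ x) ^ 2 := by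
    simp_rw [mul_pow]
    exact Finset.sum_le_sum_of_subset_of_nonneg (Finset.subset_univ _)
      fun _ _ _ => by positivity
  have ha0 : 0 ≤ ∑ i, weights Φ ω i * ((Φ i).ofLp ⬝ᵥ x) ^ 2 :=
    Finset.sum_nonneg fun i _ => mul_nonneg (weights_nonneg hΦ ω i) (sq_nonneg _)
  set a := ∑ i, weights Φ ω i * ((Φ i).ofLp ⬝ᵥ x) ^ 2
  rcases ha0.eq_or_lt with h0 | hpos
  · rw [← h0]; positivity
  · refine le_of_mul_le_mul_left ?_ hpos
    calc a * a = a ^ 2 := by ring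
      _ ≤ _ := hCS
      _ ≤ (chi Φ ω * a) * ∑ i ∈ T, ((Φ i).ofLp ⬝ᵥ x) ^ 2 := by gcongr; exact h2.trans hW
      _ = _ := by ring

end AlgorithmOutput

/-! ### Whitening and Loewner monotonicity of determinant and inverse. -/

section Whitening

open Matrix

variable {κ : Type*} [Fintype κ] [DecidableEq κ]

theorem exists_whitening {S : Matrix κ κ ℝ} (hS : S.PosDef) :
    ∃ B : Matrix κ κ ℝ, B * S * Bᵀ = 1 ∧ S * (Bᵀ * B) = 1 ∧ S⁻¹ = Bᵀ * B := by
  obtain ⟨U, -, h2, h3⟩ := isHermitian_eq_conj_diagonal hS.isHermitian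
  set d := hS.isHermitian.eigenvalues with hd
  have hpos : ∀ i, 0 < d i := hS.eigenvalues_pos
  set B : Matrix κ κ ℝ := diagonal (fun i => (Real.sqrt (d i))⁻¹) * Uᵀ with hB
  have h1 : B * S * Bᵀ = 1 := by
    have e : B * S * Bᵀ = diagonal (fun i => (Real.sqrt (d i))⁻¹) * ((Uᵀ * U) * diagonal d * (Uᵀ * U))
        * diagonal (fun i => (Real.sqrt (d i))⁻¹) := by
      rw [h3, hB, transpose_mul, transpose_transpose, diagonal_transpose]
      simp only [Matrix.mul_assoc]
    rw [e, h2, Matrix.one_mul, Matrix.mul_one, diagonal_mul_diagonal, diagonal_mul_diagonal,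
      ← diagonal_one]
    congr 1
    funext i
    have := Real.sqrt_pos.2 (hpos i)
    have h := Real.mul_self_sqrt (hpos i).le
    field_simp
    nlinarith
  have h4 : S * (Bᵀ * B) = 1 := by
    rw [← Matrix.mul_assoc]
    rw [Matrix.mul_assoc] at h1
    exact mul_eq_one_comm.1 h1
  exact ⟨B, h1, h4, Matrix.inv_eq_right_inv h4⟩

theorem le_eigenvalues_of_le {A : Matrix κ κ ℝ} (hA : A.IsHermitian) {c : ℝ}
    (h : ∀ x : κ → ℝ, c * (x ⬝ᵥ x) ≤ x ⬝ᵥ A *ᵥ x) (i : κ) : c ≤ hA.eigenvalues i := by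
  set v : κ → ℝ := (hA.eigenvectorBasis i).ofLp with hv
  have h1 : A *ᵥ v = hA.eigenvalues i • v := hA.mulVec_eigenvectorBasis i
  have h2 : v ⬝ᵥ v = 1 := by
    have := hA.eigenvectorBasis.orthonormal.1 i
    rw [EuclideanSpace.norm_eq, Real.sqrt_eq_one] at this
    simpa [dotProduct, pow_two] using this
  have h3 := h v
  rw [h1, dotProduct_smul, h2, smul_eq_mul] at h3
  linarith

theorem pow_mul_det_le {S A : Matrix κ κ ℝ} (hS : S.PosDef) (hA : A.IsHermitian) {c : ℝ}
    (hc : 0 ≤ c) (h : ∀ x : κ → ℝ, c * (x ⬝ᵥ S *ᵥ x) ≤ x ⬝ᵥ A *ᵥ x) :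
    c ^ Fintype.card κ * S.det ≤ A.det := by
  obtain ⟨B, h1, -, -⟩ := exists_whitening hS
  have hH : (B * A * Bᵀ).IsHermitian := by
    rw [IsHermitian, conjTranspose_eq_transpose_of_trivial] at hA ⊢
    rw [transpose_mul, transpose_mul, transpose_transpose, hA, Matrix.mul_assoc]
  have hconj : ∀ (M : Matrix κ κ ℝ) (x : κ → ℝ),
      x ⬝ᵥ (B * M * Bᵀ) *ᵥ x = (Bᵀ *ᵥ x) ⬝ᵥ M *ᵥ (Bᵀ *ᵥ x) := by
    intro M x
    rw [← mulVec_mulVec, ← mulVec_mulVec, dotProduct_mulVec, ← mulVec_transpose]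
  have hle : ∀ x : κ → ℝ, c * (x ⬝ᵥ x) ≤ x ⬝ᵥ (B * A * Bᵀ) *ᵥ x := by
    intro x
    have e := hconj S x
    rw [h1, one_mulVec] at e
    rw [e, hconj]
    exact h _
  have hdet : c ^ Fintype.card κ ≤ (B * A * Bᵀ).det := by
    rw [hH.det_eq_prod_eigenvalues, ← Finset.card_univ, ← Finset.prod_const]
    exact Finset.prod_le_prod (fun _ _ => hc) fun i _ => le_eigenvalues_of_le hH hle i
  have h2 := congrArg det h1
  rw [det_mul, det_mul, det_transpose, det_one] at h2
  rw [det_mul, det_mul, det_transpose] at hdet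
  have hSdet := hS.det_pos
  calc c ^ Fintype.card κ * S.det ≤ (B.det * A.det * B.det) * S.det := by gcongr
    _ = (B.det * S.det * B.det) * A.det := by ring
    _ = A.det := by rw [h2, one_mul]

/-- With `z = Q⁻¹ x` and `y = P⁻¹ x`, expand `0 ≤ (z - y)ᵀ P (z - y)` and bound `zᵀ P z ≤ zᵀ Q z =
xᵀ z`. -/
theorem dotProduct_inv_mulVec_le {P Q : Matrix κ κ ℝ} (hP : P.PosDef) (hQ : Q.PosDef)
    (h : ∀ x : κ → ℝ, x ⬝ᵥ P *ᵥ x ≤ x ⬝ᵥ Q *ᵥ x) (x : κ → ℝ) :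
    x ⬝ᵥ Q⁻¹ *ᵥ x ≤ x ⬝ᵥ P⁻¹ *ᵥ x := by
  have hPu : IsUnit P.det := (isUnit_iff_isUnit_det _).1 hP.isUnit
  have hQu : IsUnit Q.det := (isUnit_iff_isUnit_det _).1 hQ.isUnit
  set z := Q⁻¹ *ᵥ x with hz
  set y := P⁻¹ *ᵥ x with hy
  have hQz : Q *ᵥ z = x := by rw [hz, mulVec_mulVec, mul_nonsing_inv _ hQu, one_mulVec]
  have hPy : P *ᵥ y = x := by rw [hy, mulVec_mulVec, mul_nonsing_inv _ hPu, one_mulVec]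
  have h0 := hP.posSemidef.dotProduct_mulVec_nonneg (z - y)
  have hsymm : y ⬝ᵥ P *ᵥ z = x ⬝ᵥ z := by
    rw [dotProduct_mulVec, ← mulVec_transpose,
      ← conjTranspose_eq_transpose_of_trivial, hP.isHermitian.eq, hPy]
  rw [star_trivial, mulVec_sub, dotProduct_sub, sub_dotProduct, sub_dotProduct, hPy, hsymm,
    dotProduct_comm z x, dotProduct_comm y x] at h0
  have h1 := h z
  rw [hQz, dotProduct_comm z x] at h1
  linarith

theorem trace_inv_le {S A : Matrix κ κ ℝ} (hS : S.PosDef) (hA : A.PosDef) {c : ℝ} (hc : 0 < c)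
    (h : ∀ x : κ → ℝ, c * (x ⬝ᵥ S *ᵥ x) ≤ x ⬝ᵥ A *ᵥ x) :
    A⁻¹.trace ≤ c⁻¹ * S⁻¹.trace := by
  have hSu : IsUnit S.det := (isUnit_iff_isUnit_det _).1 hS.isUnit
  have hinv : (c • S)⁻¹ = c⁻¹ • S⁻¹ := by
    refine Matrix.inv_eq_right_inv ?_
    rw [smul_mul_smul_comm, mul_nonsing_inv _ hSu, mul_inv_cancel₀ hc.ne', one_smul]
  rw [← smul_eq_mul, ← trace_smul, ← hinv]
  refine Finset.sum_le_sum fun i _ => ?_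
  have := dotProduct_inv_mulVec_le (hS.smul hc) hA
    (fun x => by simpa [smul_mulVec, dotProduct_smul] using h x) (Pi.single i 1)
  simpa using this

end Whitening

/-! ### Closed forms and comparison of `ρ_d` and `ρ_e`. -/

section PerformanceMeasures

open Matrix

variable {n : ℕ} {ι : Type*} [Fintype ι]

theorem integral_sq_noise (σ : ℝ) (a : ι → ℝ) :
    Integrable (fun ξ : ι → ℝ => (a ⬝ᵥ ξ) ^ 2) (noiseLaw ι σ) ∧
      ∫ ξ, (a ⬝ᵥ ξ) ^ 2 ∂(noiseLaw ι σ) = σ ^ 2 * ∑ i, a i ^ 2 := by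
  have hm : ∀ i, MemLp (fun t : ℝ => a i * t) 2 (gaussianReal 0 (Real.toNNReal (σ ^ 2))) :=
    fun i => (memLp_id_gaussianReal' 2 (by simp)).const_mul (a i)
  have hm' : ∀ i, MemLp (fun ξ : ι → ℝ => a i * ξ i) 2 (noiseLaw ι σ) := fun i =>
    (hm i).comp_measurePreserving (measurePreserving_eval _ i)
  have e : (fun ξ : ι → ℝ => a ⬝ᵥ ξ) = ∑ i, fun ξ : ι → ℝ => a i * ξ i := by
    funext ξ
    simp [dotProduct]
  have hM : MemLp (fun ξ : ι → ℝ => a ⬝ᵥ ξ) 2 (noiseLaw ι σ) := by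
    rw [e]
    exact memLp_finsetSum' _ fun i _ => hm' i
  refine ⟨hM.integrable_sq, ?_⟩
  have hzero : ∫ ξ, a ⬝ᵥ ξ ∂(noiseLaw ι σ) = 0 := by
    simp only [dotProduct]
    have hp : IsProbabilityMeasure (noiseLaw ι σ) := by unfold noiseLaw; infer_instance
    rw [integral_finsetSum _ fun i _ => (hm' i).integrable (by norm_num)]
    refine Finset.sum_eq_zero fun i _ => ?_
    rw [integral_const_mul, noiseLaw, integral_eval, integral_id_gaussianReal, mul_zero]
  rw [← variance_of_integral_eq_zero hM.aestronglyMeasurable.aemeasurable hzero, e, noiseLaw,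
    variance_sum_pi (X := fun i t => a i * t) hm, Finset.mul_sum]
  refine Finset.sum_congr rfl fun i _ => ?_
  rw [variance_const_mul, variance_fun_id_gaussianReal, Real.coe_toNNReal _ (sq_nonneg σ)]
  ring

/-- The error is `A ξ` with `A = S⁻¹ Tᵀ`, and `A Aᵀ = S⁻¹`. -/
theorem rhoD_eq {Φ : ι → EuclideanSpace ℝ (Fin n)} (hΦ : IsFrame Φ) (σ : ℝ)
    (x₀ : EuclideanSpace ℝ (Fin n)) :
    rhoD σ x₀ Φ = Real.sqrt (σ ^ 2 * (frameMatrix Φ)⁻¹.trace) := by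
  have hu : IsUnit (frameMatrix Φ).det := (isUnit_iff_isUnit_det _).1 hΦ.posDef.isUnit
  set A := (frameMatrix Φ)⁻¹ * (analysisMatrix Φ)ᵀ with hA
  have h1 : ∀ ξ : ι → ℝ, ‖lsEstimate Φ ((analysisMatrix Φ).mulVec x₀.ofLp + ξ) - x₀‖ ^ 2
      = ∑ k, (A k ⬝ᵥ ξ) ^ 2 := by
    intro ξ
    have e : (lsEstimate Φ ((analysisMatrix Φ).mulVec x₀.ofLp + ξ) - x₀).ofLp = A *ᵥ ξ := by
      rw [lsEstimate, WithLp.ofLp_sub, ← hA, mulVec_add, mulVec_mulVec, hA, Matrix.mul_assoc]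
      change ((frameMatrix Φ)⁻¹ * frameMatrix Φ) *ᵥ _ + _ - _ = _
      rw [nonsing_inv_mul _ hu, one_mulVec, add_sub_cancel_left]
    rw [EuclideanSpace.norm_sq_eq]
    refine Finset.sum_congr rfl fun k _ => ?_
    rw [Real.norm_eq_abs, sq_abs, e]
    rfl
  rw [rhoD]
  simp_rw [h1]
  rw [integral_finsetSum _ fun k _ => (integral_sq_noise σ (A k)).1]
  simp_rw [(integral_sq_noise σ _).2]
  rw [← Finset.mul_sum]
  congr 2
  have h2 : A * Aᵀ = (frameMatrix Φ)⁻¹ := by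
    have hs : (frameMatrix Φ)ᵀ = frameMatrix Φ := (frameMatrix_isHermitian Φ).eq
    rw [hA, transpose_mul, transpose_transpose, transpose_nonsing_inv, hs, Matrix.mul_assoc,
      ← Matrix.mul_assoc _ (analysisMatrix Φ)]
    change (frameMatrix Φ)⁻¹ * (frameMatrix Φ * (frameMatrix Φ)⁻¹) = _
    rw [mul_nonsing_inv _ hu, Matrix.mul_one]
  rw [← h2]
  simp [trace, Matrix.mul_apply, pow_two]

theorem rhoD_pos {Φ : ι → EuclideanSpace ℝ (Fin n)} (hn : 0 < n) (hΦ : IsFrame Φ) {σ : ℝ}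
    (hσ : 0 < σ) (x₀ : EuclideanSpace ℝ (Fin n)) : 0 < rhoD σ x₀ Φ := by
  have : Nonempty (Fin n) := ⟨⟨0, hn⟩⟩
  have := hΦ.posDef.inv.trace_pos
  rw [rhoD_eq hΦ]
  positivity

theorem rhoE_eq {Φ : ι → EuclideanSpace ℝ (Fin n)} (hΦ : IsFrame Φ) :
    rhoE Φ = -Real.log (frameMatrix Φ).det := by
  rw [rhoE, (frameMatrix_isHermitian Φ).det_eq_prod_eigenvalues]
  simp only [RCLike.ofReal_real_eq_id, id]
  rw [Real.log_prod fun i _ => (hΦ.posDef.eigenvalues_pos i).ne']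

variable {ι' : Type*} [Fintype ι'] {Φ : ι → EuclideanSpace ℝ (Fin n)}
  {Ψ : ι' → EuclideanSpace ℝ (Fin n)} {c : ℝ}

theorem rhoD_sub_div_le (hn : 0 < n) (hΦ : IsFrame Φ) (hc : 0 < c)
    (h : ∀ x, c * (x ⬝ᵥ frameMatrix Φ *ᵥ x) ≤ x ⬝ᵥ frameMatrix Ψ *ᵥ x) {σ : ℝ}
    (hσ : 0 < σ) (x₀ : EuclideanSpace ℝ (Fin n)) :
    (rhoD σ x₀ Ψ - rhoD σ x₀ Φ) / rhoD σ x₀ Φ ≤ -1 + Real.sqrt c⁻¹ := by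
  have hΨ := hΦ.of_le hc h
  rw [div_le_iff₀ (rhoD_pos hn hΦ hσ x₀), add_mul, rhoD_eq hΦ, rhoD_eq hΨ,
    ← Real.sqrt_mul (inv_nonneg.2 hc.le)]
  have h1 := Real.sqrt_le_sqrt (mul_le_mul_of_nonneg_left
    (trace_inv_le hΦ.posDef hΨ.posDef hc h) (sq_nonneg σ))
  rw [mul_left_comm] at h1
  linarith

theorem rhoE_sub_le (hΦ : IsFrame Φ) (hc : 0 < c)
    (h : ∀ x, c * (x ⬝ᵥ frameMatrix Φ *ᵥ x) ≤ x ⬝ᵥ frameMatrix Ψ *ᵥ x) :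
    rhoE Ψ - rhoE Φ ≤ n * Real.log c⁻¹ := by
  have hΨ := hΦ.of_le hc h
  have h1 := pow_mul_det_le hΦ.posDef (frameMatrix_isHermitian Ψ) hc.le h
  have hd := hΦ.posDef.det_pos
  have h2 := Real.log_le_log (by positivity) h1
  rw [Real.log_mul (by positivity) hd.ne', Real.log_pow, Fintype.card_fin] at h2
  rw [rhoE_eq hΦ, rhoE_eq hΨ, Real.log_inv]
  linarith

end PerformanceMeasures

/-! ### Probability of a good draw, and Markov's inequality for `χ`. -/

section Sampling

open Matrix

variable {n m : ℕ} {Φ : Fin m → EuclideanSpace ℝ (Fin n)}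

instance drawsLaw_isProbabilityMeasure (hn : 0 < n) (hΦ : IsFrame Φ) (q : ℕ) :
    IsProbabilityMeasure (drawsLaw Φ hn hΦ q) := by
  unfold drawsLaw
  infer_instance

theorem samplingProb_nonneg (hΦ : IsFrame Φ) (i : Fin m) : 0 ≤ samplingProb Φ i :=
  div_nonneg (leverage_nonneg hΦ i) (Nat.cast_nonneg n)

theorem sum_samplingProb (hn : 0 < n) (hΦ : IsFrame Φ) : ∑ i, samplingProb Φ i = 1 := by
  simp only [samplingProb]
  rw [← Finset.sum_div, sum_leverage hΦ, div_self (by positivity)]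

theorem drawsLaw_real_singleton (hn : 0 < n) (hΦ : IsFrame Φ) (q : ℕ) (ω : Fin q → Fin m) :
    (drawsLaw Φ hn hΦ q).real {ω} = ∏ j, samplingProb Φ (ω j) := by
  rw [measureReal_def, drawsLaw, Measure.pi_singleton, ENNReal.toReal_prod]
  refine Finset.prod_congr rfl fun j _ => ?_
  rw [PMF.toMeasure_apply_singleton _ _ (measurableSet_singleton _), leveragePMF,
    PMF.ofFintype_apply, ENNReal.toReal_ofReal (samplingProb_nonneg hΦ _)]

/-- The projection onto the line spanned by a whitened frame vector. -/
noncomputable def whitenedProj (Φ : Fin m → EuclideanSpace ℝ (Fin n))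
    (B : Matrix (Fin n) (Fin n) ℝ) (i : Fin m) : Matrix (Fin n) (Fin n) ℝ :=
  (leverage Φ i)⁻¹ • vecMulVec (B *ᵥ (Φ i).ofLp) (B *ᵥ (Φ i).ofLp)

theorem whitenedProj_isSymm (B : Matrix (Fin n) (Fin n) ℝ) (i : Fin m) :
    (whitenedProj Φ B i).IsSymm := by
  rw [whitenedProj, IsSymm, transpose_smul, transpose_vecMulVec]

theorem dotProduct_whitenedProj_mulVec (B : Matrix (Fin n) (Fin n) ℝ) (i : Fin m)
    (x : Fin n → ℝ) :
    x ⬝ᵥ whitenedProj Φ B i *ᵥ x = (leverage Φ i)⁻¹ * ((Φ i).ofLp ⬝ᵥ Bᵀ *ᵥ x) ^ 2 := by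
  have e : x ⬝ᵥ B *ᵥ (Φ i).ofLp = (Φ i).ofLp ⬝ᵥ Bᵀ *ᵥ x := by
    rw [dotProduct_mulVec, mulVec_transpose, dotProduct_comm]
  rw [whitenedProj, smul_mulVec, vecMulVec_mulVec, dotProduct_smul, smul_eq_mul]
  simp [dotProduct_comm _ x, e, pow_two]

theorem whitened_dotProduct_self {B : Matrix (Fin n) (Fin n) ℝ}
    (hinv : (frameMatrix Φ)⁻¹ = Bᵀ * B) (i : Fin m) :
    (B *ᵥ (Φ i).ofLp) ⬝ᵥ (B *ᵥ (Φ i).ofLp) = leverage Φ i := by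
  rw [leverage, hinv, ← mulVec_mulVec, dotProduct_mulVec _ Bᵀ, vecMul_transpose]

theorem whitenedProj_mul_self {B : Matrix (Fin n) (Fin n) ℝ}
    (hinv : (frameMatrix Φ)⁻¹ = Bᵀ * B) (i : Fin m) :
    whitenedProj Φ B i * whitenedProj Φ B i = whitenedProj Φ B i := by
  rw [whitenedProj, smul_mul_smul_comm, vecMulVec_mul_vecMulVec, whitened_dotProduct_self hinv]
  -- At zero leverage the inverse defaults to `0`, so the matrix is zero and still idempotent.
  rcases eq_or_ne (leverage Φ i) 0 with h | h
  · simp [h]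
  · rw [vecMulVec_smul, smul_smul, mul_assoc, inv_mul_cancel₀ h, mul_one]

theorem sum_samplingProb_smul_whitenedProj {B : Matrix (Fin n) (Fin n) ℝ}
    (hinv : (frameMatrix Φ)⁻¹ = Bᵀ * B)
    (hw : B * frameMatrix Φ * Bᵀ = 1) :
    ∑ i, samplingProb Φ i • whitenedProj Φ B i = ((n : ℝ)⁻¹) • 1 := by
  have e1 : ∀ i, samplingProb Φ i • whitenedProj Φ B i
      = (n : ℝ)⁻¹ • vecMulVec (B *ᵥ (Φ i).ofLp) (B *ᵥ (Φ i).ofLp) := by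
    intro i
    rw [whitenedProj, samplingProb, smul_smul]
    rcases eq_or_ne (leverage Φ i) 0 with h | h
    · have hv : B *ᵥ (Φ i).ofLp = 0 := by
        rw [← whitened_dotProduct_self hinv] at h
        exact dotProduct_self_eq_zero.1 h
      simp [hv]
    · congr 1
      field_simp
  simp_rw [e1]
  rw [← Finset.smul_sum, ← hw]
  congr 1
  have e2 : frameMatrix Φ = ∑ i, vecMulVec (Φ i).ofLp (Φ i).ofLp := by
    ext a b
    simp [frameMatrix, analysisMatrix, Matrix.mul_apply, Matrix.sum_apply, vecMulVec_apply]
  rw [e2, Matrix.mul_sum, Matrix.sum_mul]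
  refine Finset.sum_congr rfl fun i _ => ?_
  rw [mul_vecMulVec, vecMulVec_mul, vecMul_transpose]

/-- The reweighted frame matrix dominates the multiple `1 - δ` of the frame matrix. -/
def IsGoodDraw (Φ : Fin m → EuclideanSpace ℝ (Fin n)) (δ : ℝ) {q : ℕ} (ω : Fin q → Fin m) :
    Prop :=
  ∀ x, (1 - δ) * (x ⬝ᵥ frameMatrix Φ *ᵥ x) ≤ ∑ i, weights Φ ω i * ((Φ i).ofLp ⬝ᵥ x) ^ 2

theorem drawsLaw_real_not_isGoodDraw_le (hn : 0 < n) (hΦ : IsFrame Φ) {q : ℕ} (hq : 0 < q)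
    {δ : ℝ} (hδ : 0 < δ) :
    (drawsLaw Φ hn hΦ q).real {ω | ¬ IsGoodDraw Φ δ ω}
      ≤ n * Real.exp (-(δ ^ 2 / 2) * (q * (n : ℝ)⁻¹)) := by
  classical
  obtain ⟨B, hw, hinv', hinv⟩ := exists_whitening hΦ.posDef
  have hn' : (0 : ℝ) < n := by exact_mod_cast hn
  have hq' : (0 : ℝ) < q := by exact_mod_cast hq
  have hn1 : ((n : ℝ)⁻¹) ≤ 1 := inv_le_one_of_one_le₀ (by exact_mod_cast hn)
  have h := sum_prod_not_le q (samplingProb_nonneg hΦ) (sum_samplingProb hn hΦ)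
    (whitenedProj_isSymm B) (whitenedProj_mul_self hinv)
    (sum_samplingProb_smul_whitenedProj hinv hw) (inv_nonneg.2 hn'.le) hn1 hδ
  rw [Fintype.card_fin] at h
  refine le_trans ?_ h
  simp_rw [← drawsLaw_real_singleton hn hΦ q]
  rw [sum_measureReal_singleton]
  refine measureReal_mono (fun ω hω => ?_)
  simp only [Finset.coe_filter, Finset.mem_univ, true_and, Set.mem_ofPred_eq] at hω ⊢
  refine mt (fun hgood x => ?_) hω
  have hsymm : (frameMatrix Φ)ᵀ = frameMatrix Φ := (frameMatrix_isHermitian Φ).eq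
  have hy : Bᵀ *ᵥ (B *ᵥ (frameMatrix Φ *ᵥ x)) = x := by
    rw [mulVec_mulVec, mulVec_mulVec, mul_eq_one_comm.1 hinv', one_mulVec]
  -- Testing at `B S x` undoes the whitening, because `Bᵀ B S = 1`.
  have h1 := hgood (B *ᵥ (frameMatrix Φ *ᵥ x))
  rw [sum_mulVec, dotProduct_sum] at h1
  simp_rw [dotProduct_whitenedProj_mulVec, hy] at h1
  have e : (B *ᵥ (frameMatrix Φ *ᵥ x)) ⬝ᵥ (B *ᵥ (frameMatrix Φ *ᵥ x))
      = x ⬝ᵥ frameMatrix Φ *ᵥ x := by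
    rw [dotProduct_mulVec, ← mulVec_transpose, hy]
  rw [e] at h1
  rw [sum_weights_mul]
  have e2 : ∑ j, ((q : ℝ) * samplingProb Φ (ω j))⁻¹ * ((Φ (ω j)).ofLp ⬝ᵥ x) ^ 2
      = (n / q) * ∑ j, (leverage Φ (ω j))⁻¹ * ((Φ (ω j)).ofLp ⬝ᵥ x) ^ 2 := by
    rw [Finset.mul_sum]
    refine Finset.sum_congr rfl fun j _ => ?_
    rw [samplingProb, mul_inv, inv_div]
    ring
  rw [e2]
  calc _ = (n / q) * ((1 - δ) * (q * (n : ℝ)⁻¹) * (x ⬝ᵥ frameMatrix Φ *ᵥ x)) := by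
        field_simp
    _ ≤ _ := by gcongr

theorem isGoodDraw_probability (hn : 0 < n) (hΦ : IsFrame Φ) {ε : ℝ} (hε : 1 / Real.sqrt n < ε)
    (hε1 : ε ≤ 1) {q : ℕ} (hq : 16 * (n * Real.log n / ε ^ 2) ≤ q) :
    1 / 2 ≤ (drawsLaw Φ hn hΦ q).real {ω | IsGoodDraw Φ (ε / 2) ω} := by
  have hn' : (0 : ℝ) < n := by exact_mod_cast hn
  have hε0 : 0 < ε := lt_of_le_of_lt (by positivity) hε
  -- The range of `ε` is empty for `n = 1`, where `log n = 0` would allow `q = 0`.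
  have hn2 : 2 ≤ n := by
    by_contra hlt
    have : n = 1 := by omega
    subst this
    norm_num at hε
    linarith
  have hn2' : (2 : ℝ) ≤ n := by exact_mod_cast hn2
  have hlog : 0 < Real.log n := Real.log_pos (by linarith)
  have hq0 : 0 < q := by
    have : (0 : ℝ) < q := lt_of_lt_of_le (by positivity) hq
    exact_mod_cast this
  have hbad := drawsLaw_real_not_isGoodDraw_le hn hΦ hq0 (half_pos hε0)
  -- Since `(ε/2)²/2 = ε²/8`, the constant `16` makes the failure bound `n · n⁻² = 1/n ≤ 1/2`.
  have hexp : -((ε / 2) ^ 2 / 2) * (q * (n : ℝ)⁻¹) ≤ -(2 * Real.log n) := by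
    have : 2 * Real.log n = ((ε / 2) ^ 2 / 2) * (16 * (n * Real.log n / ε ^ 2) * (n : ℝ)⁻¹) := by
      field_simp
      norm_num
    rw [this, neg_mul]
    gcongr
  have hle : n * Real.exp (-((ε / 2) ^ 2 / 2) * (q * (n : ℝ)⁻¹)) ≤ 1 / 2 := by
    calc _ ≤ n * Real.exp (-(2 * Real.log n)) := by gcongr
      _ = (n : ℝ)⁻¹ := by
        rw [Real.exp_neg, mul_comm 2, Real.exp_mul, Real.exp_log hn']
        norm_num
        field_simp
      _ ≤ 2⁻¹ := by gcongr
      _ = 1 / 2 := by norm_num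
  have hcompl := probReal_compl_eq_one_sub (μ := drawsLaw Φ hn hΦ q)
    (Set.toFinite {ω | IsGoodDraw Φ (ε / 2) ω}).measurableSet
  rw [Set.compl_ofPred] at hcompl
  linarith

theorem IsGoodDraw.mul_le {δ : ℝ} {q : ℕ} {ω : Fin q → Fin m} (h : IsGoodDraw Φ δ ω)
    (hΦ : IsFrame Φ) (x : Fin n → ℝ) :
    (1 - δ) * (x ⬝ᵥ frameMatrix Φ *ᵥ x)
      ≤ chi Φ ω * (x ⬝ᵥ frameMatrix (sparsified Φ ω) *ᵥ x) :=
  (h x).trans (sum_weights_le_chi_mul hΦ ω x)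

theorem IsFrame.exists_dotProduct_pos {ι : Type*} [Fintype ι] {Φ : ι → EuclideanSpace ℝ (Fin n)}
    (hn : 0 < n) (hΦ : IsFrame Φ) : ∃ x, 0 < x ⬝ᵥ frameMatrix Φ *ᵥ x := by
  refine ⟨Pi.single ⟨0, hn⟩ 1, ?_⟩
  simpa using hΦ.posDef.dotProduct_mulVec_pos (x := Pi.single ⟨0, hn⟩ 1) (by simp)

theorem IsGoodDraw.chi_pos {δ : ℝ} (hδ : δ < 1) {q : ℕ} {ω : Fin q → Fin m}
    (h : IsGoodDraw Φ δ ω) (hn : 0 < n) (hΦ : IsFrame Φ) : 0 < chi Φ ω := by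
  obtain ⟨x, hx⟩ := hΦ.exists_dotProduct_pos hn
  refine lt_of_le_of_ne (chi_nonneg ω) fun h0 => ?_
  have h1 := h.mul_le hΦ x
  rw [← h0, zero_mul] at h1
  nlinarith

theorem IsGoodDraw.div_mul_le {δ ε : ℝ} (hδ : δ ≤ ε) {q : ℕ} {ω : Fin q → Fin m}
    (h : IsGoodDraw Φ δ ω) (hΦ : IsFrame Φ) {K : ℝ} (hK0 : 0 < K) (hK : chi Φ ω ≤ K)
    (x : Fin n → ℝ) :
    (K / (1 - ε))⁻¹ * (x ⬝ᵥ frameMatrix Φ *ᵥ x)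
      ≤ x ⬝ᵥ frameMatrix (sparsified Φ ω) *ᵥ x := by
  have h0 : 0 ≤ x ⬝ᵥ frameMatrix Φ *ᵥ x := by
    rw [dotProduct_frameMatrix_mulVec]; positivity
  have h0' : 0 ≤ x ⬝ᵥ frameMatrix (sparsified Φ ω) *ᵥ x := by
    rw [dotProduct_frameMatrix_mulVec]; positivity
  rw [inv_div, div_mul_eq_mul_div, div_le_iff₀ hK0, mul_comm _ K]
  calc _ ≤ (1 - δ) * (x ⬝ᵥ frameMatrix Φ *ᵥ x) := by gcongr
    _ ≤ _ := h.mul_le hΦ x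
    _ ≤ _ := by gcongr

theorem isFrame_sparsified_of_isGoodDraw {δ : ℝ} (hδ : δ < 1) {q : ℕ} {ω : Fin q → Fin m}
    (h : IsGoodDraw Φ δ ω) (hn : 0 < n) (hΦ : IsFrame Φ) : IsFrame (sparsified Φ ω) := by
  have hχ := h.chi_pos hδ hn hΦ
  exact hΦ.of_le (inv_pos.2 (div_pos hχ (sub_pos.2 hδ)))
    (h.div_mul_le le_rfl hΦ hχ le_rfl)

theorem chiBar_pos (hn : 0 < n) (hΦ : IsFrame Φ) {δ : ℝ} (hδ : δ < 1) {q : ℕ}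
    (hP : 1 / 2 ≤ (drawsLaw Φ hn hΦ q).real {ω | IsGoodDraw Φ δ ω}) :
    0 < chiBar Φ hn hΦ q := by
  refine (integral_pos_iff_support_of_nonneg chi_nonneg .of_finite).2 ?_
  have hpos : 0 < (drawsLaw Φ hn hΦ q).real (Function.support (chi Φ)) :=
    lt_of_lt_of_le (by norm_num) (hP.trans (measureReal_mono fun ω hω =>
      (IsGoodDraw.chi_pos hδ hω hn hΦ).ne'))
  exact ENNReal.toReal_pos_iff.1 hpos |>.1

theorem isGoodDraw_and_chi_le_probability (hn : 0 < n) (hΦ : IsFrame Φ) {δ : ℝ} (hδ : δ < 1)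
    {q : ℕ} (hP : 1 / 2 ≤ (drawsLaw Φ hn hΦ q).real {ω | IsGoodDraw Φ δ ω}) :
    1 / 4 ≤ (drawsLaw Φ hn hΦ q).real
      {ω | IsGoodDraw Φ δ ω ∧ chi Φ ω ≤ 4 * chiBar Φ hn hΦ q} := by
  have hpos := chiBar_pos hn hΦ hδ hP
  have hM := mul_meas_ge_le_integral_of_nonneg (μ := drawsLaw Φ hn hΦ q) (f := chi Φ)
    (Filter.Eventually.of_forall chi_nonneg) .of_finite (4 * chiBar Φ hn hΦ q)
  change _ ≤ chiBar Φ hn hΦ q at hM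
  have hM' : (drawsLaw Φ hn hΦ q).real {ω | 4 * chiBar Φ hn hΦ q ≤ chi Φ ω} ≤ 1 / 4 := by
    refine le_of_mul_le_mul_left (hM.trans ?_) (by positivity : 0 < 4 * chiBar Φ hn hΦ q)
    linarith
  have hsub : {ω : Fin q → Fin m | IsGoodDraw Φ δ ω} ⊆
      {ω | IsGoodDraw Φ δ ω ∧ chi Φ ω ≤ 4 * chiBar Φ hn hΦ q} ∪
        {ω | 4 * chiBar Φ hn hΦ q ≤ chi Φ ω} := by
    intro ω hω
    rcases le_total (chi Φ ω) (4 * chiBar Φ hn hΦ q) with h | h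
    · exact Or.inl ⟨hω, h⟩
    · exact Or.inr h
  have := (measureReal_mono hsub (μ := drawsLaw Φ hn hΦ q)).trans (measureReal_union_le _ _)
  linarith

end Sampling

end FrameSparsification

theorem mainTheorem7 :
    ∃ C : ℝ, 0 < C ∧
      ∀ (n m : ℕ) (hn : 0 < n) (Φ : Fin m → EuclideanSpace ℝ (Fin n)) (hΦ : IsFrame Φ)
        (ε : ℝ), 1 / Real.sqrt n < ε → ε ≤ 1 →
        ∀ q : ℕ, C * (n * Real.log n / ε ^ 2) ≤ q →
          1 / 2 ≤ (drawsLaw Φ hn hΦ q).real {ω | IsFrame (sparsified Φ ω)} ∧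
          (ε < 1 →
            (∀ (σ : ℝ), 0 < σ → ∀ x₀ : EuclideanSpace ℝ (Fin n),
              1 / 4 ≤ (drawsLaw Φ hn hΦ q).real {ω |
                IsFrame (sparsified Φ ω) ∧
                (rhoD σ x₀ (sparsified Φ ω) - rhoD σ x₀ Φ) / rhoD σ x₀ Φ
                  ≤ -1 + Real.sqrt (4 * chiBar Φ hn hΦ q / (1 - ε)) ∧
                rhoE (sparsified Φ ω) - rhoE Φ
                  ≤ n * Real.log (4 * chiBar Φ hn hΦ q / (1 - ε))}) ∧
            0 ≤ -1 + Real.sqrt (4 * chiBar Φ hn hΦ q / (1 - ε)) ∧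
            0 ≤ n * Real.log (4 * chiBar Φ hn hΦ q / (1 - ε))) := by
  refine ⟨16, by norm_num, fun n m hn Φ hΦ ε hε hε1 q hq => ?_⟩
  have hε0 : 0 < ε := lt_of_le_of_lt (by positivity) hε
  -- Halving `ε` keeps `1 - δ` positive at `ε = 1`, as the first claim needs.
  have hδ : ε / 2 < 1 := by linarith
  have hP := isGoodDraw_probability hn hΦ hε hε1 hq
  refine ⟨hP.trans (measureReal_mono fun ω hω =>
    isFrame_sparsified_of_isGoodDraw hδ hω hn hΦ), fun hlt => ?_⟩
  have hχ := chiBar_pos hn hΦ hδ hP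
  have hQ := isGoodDraw_and_chi_le_probability hn hΦ hδ hP
  have hK : 0 < 4 * chiBar Φ hn hΦ q := by positivity
  have hc : 0 < (4 * chiBar Φ hn hΦ q / (1 - ε))⁻¹ := inv_pos.2 (div_pos hK (sub_pos.2 hlt))
  refine ⟨fun σ hσ x₀ => hQ.trans (measureReal_mono fun ω ⟨hω, hωχ⟩ => ?_), ?_⟩
  · have h := hω.div_mul_le (half_le_self hε0.le) hΦ hK hωχ
    have h1 := rhoD_sub_div_le hn hΦ hc h hσ x₀
    have h2 := rhoE_sub_le hΦ hc h
    rw [inv_inv] at h1 h2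
    exact ⟨hΦ.of_le hc h, h1, h2⟩
  -- The nonnegativity claim is deterministic, so one outcome suffices; an event of probability at
  -- least `1/4` supplies it.
  · obtain ⟨ω, hω, hωχ⟩ : {ω : Fin q → Fin m | IsGoodDraw Φ (ε / 2) ω ∧
        chi Φ ω ≤ 4 * chiBar Φ hn hΦ q}.Nonempty := by
      by_contra hempty
      rw [Set.not_nonempty_iff_eq_empty.1 hempty, measureReal_empty] at hQ
      norm_num at hQ
    obtain ⟨x, hx⟩ := hΦ.exists_dotProduct_pos hn
    have h := (hω.div_mul_le (half_le_self hε0.le) hΦ hK hωχ x).trans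
      (dotProduct_frameMatrix_sparsified_le ω x)
    have hone : 1 ≤ 4 * chiBar Φ hn hΦ q / (1 - ε) :=
      (inv_le_one₀ (inv_pos.1 hc)).1 (le_of_mul_le_mul_right (by linarith) hx)
    refine ⟨?_, mul_nonneg (Nat.cast_nonneg n) (Real.log_nonneg hone)⟩
    have := Real.one_le_sqrt.2 hone
    linarith
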